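/- For a metric space $M$ with a base point $o$, let $\mathrm{Lip}_0(M)$ be the Banach space of all real-valued Lipschitz functions on $M$ that vanish at $o$, normed by the Lipschitz constant, and let the Lipschitz-free space $\mathcal F(M)$ be the closed linear span in $\mathrm{Lip}_0(M)^*$ of the evaluation functionals $\delta(p)\colon g\mapsto g(p)$, $p\in M$. A Banach space $X$ is isometric to a $\lambda$-complemented subspace of a Banach space $Y$ if there are a linear isometric embedding $J\colon X\to Y$ and a bounded linear projection $P\colon Y\to Y$ with $P(Y)=J(X)$ and $\|P\|\le\lambda$. For $1\le\lambda<\infty$, a Banach space $X$ has the $\lambda$-bounded approximation property if for every $\varepsilon>0$ and every compact $K\subset X$ there is a bounded finite-rank linear operator $T\colon X\to X$ with $\|T\|\le\lambda$ and $\|Tx-x\|\le\varepsilon$ for all $x\in K$. **Proposition.** There is a universal constant $C>0$ such that for every integer $N\ge 1$ and every nonempty closed subset $F$ of $\mathbb R^N$, where $\mathbb R^N$ and $F$ carry the Euclidean distance and arbitrary base points $b\in\mathbb R^N$ and $a\in F$, the space $\mathcal F(F)$ is isometric to a $C\sqrt N$-complemented subspace of $\mathcal F(\mathbb R^N)$.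 Moreover, $\mathcal F(F)$ has the $C\sqrt N$-bounded approximation property. -/

import Mathlib

noncomputable section

namespace LipFree

/-- The Lipschitz constant of `f`: the supremum of the difference quotients of `f` over all pairs of
distinct points (it is `0` on a one-point space). -/
def lipConst {M : Type*} [MetricSpace M] (f : M → ℝ) : ℝ :=
  sSup {r : ℝ | ∃ x y : M, x ≠ y ∧ r = dist (f x) (f y) / dist x y}

/-- The vector space of real-valued Lipschitz functions on `M` that vanish at the base point `o`. -/
def lipZeroSubmodule (M : Type*) [MetricSpace M] (o : M) : Submodule ℝ (M → ℝ) where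
  carrier := {f | (∃ K : NNReal, LipschitzWith K f) ∧ f o = 0}
  add_mem' := by
    rintro f g ⟨⟨K, hf⟩, hf0⟩ ⟨⟨L, hg⟩, hg0⟩
    exact ⟨⟨K + L, hf.add hg⟩, by simp [hf0, hg0]⟩
  zero_mem' := ⟨⟨0, LipschitzWith.const 0⟩, rfl⟩
  smul_mem' := by
    rintro c f ⟨⟨K, hf⟩, hf0⟩
    exact ⟨⟨‖c‖₊ * K, (lipschitzWith_smul c).comp hf⟩, by simp [hf0]⟩

/-- `Lip₀(M)` for the pointed metric space `(M, o)`. This is a new type, so that it does not inherit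
the topology of pointwise convergence; its norm is the Lipschitz constant. -/
def LipZero (M : Type*) [MetricSpace M] (o : M) : Type _ :=
  lipZeroSubmodule M o

namespace LipZero

variable {M : Type*} [MetricSpace M] {o : M}

instance : AddCommGroup (LipZero M o) := inferInstanceAs (AddCommGroup (lipZeroSubmodule M o))

instance : Module ℝ (LipZero M o) := inferInstanceAs (Module ℝ (lipZeroSubmodule M o))

instance : CoeFun (LipZero M o) (fun _ => M → ℝ) := ⟨fun f => f.1⟩

instance : Norm (LipZero M o) := ⟨fun f => lipConst f⟩

theorem norm_def (f : LipZero M o) : ‖f‖ = lipConst f := rfl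

@[ext] theorem ext {f g : LipZero M o} (h : ∀ x, f x = g x) : f = g := Subtype.ext (funext h)

@[simp] theorem add_apply (f g : LipZero M o) (x : M) : (f + g) x = f x + g x := rfl

@[simp] theorem smul_apply (c : ℝ) (f : LipZero M o) (x : M) : (c • f) x = c * f x := rfl

@[simp] theorem zero_apply (x : M) : (0 : LipZero M o) x = 0 := rfl

@[simp] theorem apply_base (f : LipZero M o) : f o = 0 := f.2.2

theorem norm_nonneg' (f : LipZero M o) : 0 ≤ ‖f‖ := by
  apply Real.sSup_nonneg
  rintro r ⟨x, y, -, rfl⟩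
  positivity

theorem dist_apply_le (f : LipZero M o) (x y : M) : dist (f x) (f y) ≤ ‖f‖ * dist x y := by
  rcases eq_or_ne x y with rfl | h
  · simp
  · rw [← div_le_iff₀ (dist_pos.2 h)]
    refine le_csSup ?_ ⟨x, y, h, rfl⟩
    obtain ⟨K, hK⟩ := f.2.1
    refine ⟨K, ?_⟩
    rintro r ⟨x, y, hxy, rfl⟩
    rw [div_le_iff₀ (dist_pos.2 hxy)]
    exact hK.dist_le_mul x y

theorem norm_le_of_forall (f : LipZero M o) {C : ℝ} (hC : 0 ≤ C)
    (h : ∀ x y, dist (f x) (f y) ≤ C * dist x y) : ‖f‖ ≤ C := by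
  apply Real.sSup_le _ hC
  rintro r ⟨x, y, hxy, rfl⟩
  rw [div_le_iff₀ (dist_pos.2 hxy)]
  exact h x y

theorem norm_smul_le' (c : ℝ) (f : LipZero M o) : ‖c • f‖ ≤ ‖c‖ * ‖f‖ := by
  refine norm_le_of_forall _ (mul_nonneg (norm_nonneg c) (norm_nonneg' f)) fun x y => ?_
  have h := mul_le_mul_of_nonneg_left (dist_apply_le f x y) (norm_nonneg c)
  rw [Real.dist_eq] at h ⊢
  rw [smul_apply, smul_apply, ← mul_sub, abs_mul, mul_assoc]
  exact h

theorem normedSpaceCore : NormedSpace.Core ℝ (LipZero M o) where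
  norm_nonneg := norm_nonneg'
  norm_smul c f := by
    refine le_antisymm (norm_smul_le' c f) ?_
    rcases eq_or_ne c 0 with rfl | hc
    · rw [norm_zero, zero_mul]
      exact norm_nonneg' _
    · have h := norm_smul_le' c⁻¹ (c • f)
      rw [smul_smul, inv_mul_cancel₀ hc, one_smul, norm_inv] at h
      rwa [le_inv_mul_iff₀ (norm_pos_iff.2 hc)] at h
  norm_triangle f g := by
    refine norm_le_of_forall _ (add_nonneg (norm_nonneg' f) (norm_nonneg' g)) fun x y => ?_
    rw [add_mul]
    exact (dist_add_add_le _ _ _ _).trans (add_le_add (dist_apply_le f x y) (dist_apply_le g x y))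
  norm_eq_zero_iff f := by
    constructor
    · intro h
      ext x
      have hx := dist_apply_le f x o
      rw [h, zero_mul, apply_base] at hx
      simpa using hx
    · rintro rfl
      exact le_antisymm (norm_le_of_forall _ le_rfl fun x y => by simp) (norm_nonneg' _)

instance : NormedAddCommGroup (LipZero M o) := NormedAddCommGroup.ofCore normedSpaceCore

instance : NormedSpace ℝ (LipZero M o) := NormedSpace.ofCore normedSpaceCore

end LipZero

/-- The Dirac map `δ : M → Lip₀(M)*`, given by `δ p g = g p`. -/
def dirac {M : Type*} [MetricSpace M] (o : M) (p : M) : StrongDual ℝ (LipZero M o) :=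
  LinearMap.mkContinuous
    { toFun := fun g => g p
      map_add' := fun _ _ => rfl
      map_smul' := fun _ _ => rfl }
    (dist p o) (fun g => by
      have h := LipZero.dist_apply_le g p o
      rw [LipZero.apply_base, dist_zero_right, mul_comm] at h
      exact h)

/-- The Lipschitz-free space of the pointed metric space `(M, o)`: the closed linear span of the
Dirac functionals in the Banach space `Lip₀(M)*`, with the norm of `Lip₀(M)*`. -/
def FreeSpace (M : Type*) [MetricSpace M] (o : M) : Submodule ℝ (StrongDual ℝ (LipZero M o)) :=
  (Submodule.span ℝ (Set.range (dirac o))).topologicalClosure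

/-- `X` is linearly isometric to a `c`-complemented subspace of `Y`: there is a linear isometric
embedding `J` of `X` into `Y` whose range is the range of a bounded linear projection `P` of `Y` of
norm at most `c`. -/
def IsometricToComplemented (c : ℝ) (X Y : Type*) [NormedAddCommGroup X] [NormedSpace ℝ X]
    [NormedAddCommGroup Y] [NormedSpace ℝ Y] : Prop :=
  ∃ (J : X →ₗᵢ[ℝ] Y) (P : Y →L[ℝ] Y),
    (∀ y, P (P y) = P y) ∧ Set.range P = Set.range J ∧ ‖P‖ ≤ c

/-- The `c`-bounded approximation property, where `1 ≤ c < ∞`. -/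
def HasBAP (c : ℝ) (X : Type*) [NormedAddCommGroup X] [NormedSpace ℝ X] : Prop :=
  1 ≤ c ∧ ∀ ε : ℝ, 0 < ε → ∀ K : Set X, IsCompact K →
    ∃ T : X →L[ℝ] X, FiniteDimensional ℝ (LinearMap.range (T : X →ₗ[ℝ] X)) ∧ ‖T‖ ≤ c ∧
      ∀ x ∈ K, ‖T x - x‖ ≤ ε

end LipFree

end

/-!
An operator out of a Lipschitz-free space is the same as a Lipschitz map on the metric space, so
the complementation asks for a map `Φ : V → F(F)` on `V = ℝᴺ` that extends the Dirac map of `F`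
and is Lipschitz with constant of order `√N` (`exists_retraction`; that the inclusion of `F(F)` in
`F(V)` is isometric is McShane's extension theorem).

Such a `Φ` is a Gaussian average. Let `r y` be an almost nearest point of `y` in `F`, chosen
measurably, let `d(x)` be the distance of `x` from `F`, and let `Φ x` be the mean of the Dirac
functional at `r y`, for `y` Gaussian with centre `x` and standard deviation of order `d(x) / √N`
in each direction. Then `y` is at distance of order `d(x)` from `x`, so the functionals that are
averaged differ by `O(d(x))`, while the Gaussian densities for `x` and `z` have Hellinger distance
at most of order `√N * ‖x - z‖ / d(x)`: this holds for the change of centre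
(`integral_gaussRoot_sub_sq_le_of_center`) and, since the norm of a standard Gaussian vector
fluctuates by `O(1)` only, also for the change of scale (`integral_gaussRoot_sub_sq_le_of_scale`).
The Cauchy–Schwarz inequality (`norm_gaussMean_sub_le`) turns this into a Lipschitz constant
`O(√N)`.

Complemented subspaces inherit bounded approximation properties, so it remains to see that `F(V)`
has one with a constant that does not depend on `N` (`hasBAP_freeBanach`). Averaging Dirac
functionals with a Gaussian density of fixed scale `ε` gives a Lipschitz map with constant `1`,
close to the Dirac map. If `y` is replaced by `s y` before averaging, where `s` has finite range
and is within `ε` of a retraction onto a large ball, the operator acquires finite rank, and the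
translation estimate for the density shows that the Lipschitz constant grows by `O(1)` only.
-/

noncomputable section

open MeasureTheory Filter Topology

namespace LipFree

/-! ### Lipschitz-free spaces as Banach spaces -/

section Universal

variable {M N : Type*} [MetricSpace M] [MetricSpace N] {o : M} {a : N}

theorem norm_dirac_sub_le (p q : M) : ‖dirac o p - dirac o q‖ ≤ dist p q := by
  refine ContinuousLinearMap.opNorm_le_bound _ dist_nonneg fun g => ?_
  have h := LipZero.dist_apply_le g p q
  rw [Real.dist_eq, mul_comm] at h
  exact h

/-- The Lipschitz-free space as a type of its own, whose algebraic structure and topology come from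
its normed space structure alone, as instance unification requires. -/
def FreeBanach (M : Type*) [MetricSpace M] (o : M) : Type _ := FreeSpace M o

namespace FreeBanach

instance : NormedAddCommGroup (FreeBanach M o) :=
  (inferInstance : NormedAddCommGroup (FreeSpace M o))

instance : NormedSpace ℝ (FreeBanach M o) := (inferInstance : NormedSpace ℝ (FreeSpace M o))

theorem isClosed_freeSpace : IsClosed (FreeSpace M o : Set (StrongDual ℝ (LipZero M o))) :=
  Submodule.isClosed_topologicalClosure _

instance : CompleteSpace (FreeBanach M o) := (isClosed_freeSpace (M := M)).completeSpace_coe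

/-- The inclusion of the Lipschitz-free space in `Lip₀(M)*`. -/
def toDual : FreeBanach M o →ₗᵢ[ℝ] StrongDual ℝ (LipZero M o) where
  toFun μ := μ.1
  map_add' _ _ := rfl
  map_smul' _ _ := rfl
  norm_map' _ := rfl

theorem toDual_mem (μ : FreeBanach M o) : toDual μ ∈ FreeSpace M o := μ.2

/-- An element of `Lip₀(M)*` in the closed span of the Dirac functionals, as an element of the
Lipschitz-free space. -/
def mk (μ : StrongDual ℝ (LipZero M o)) (h : μ ∈ FreeSpace M o) : FreeBanach M o := ⟨μ, h⟩

@[simp] theorem toDual_mk (μ : StrongDual ℝ (LipZero M o)) (h : μ ∈ FreeSpace M o) :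
    toDual (mk μ h) = μ := rfl

theorem dirac_mem (p : M) : dirac o p ∈ FreeSpace M o :=
  Submodule.le_topologicalClosure _ (Submodule.subset_span ⟨p, rfl⟩)

/-- The Dirac functional at `p`, as an element of the Lipschitz-free space. -/
def diracMk (o p : M) : FreeBanach M o := mk (dirac o p) (dirac_mem p)

theorem norm_diracMk_sub_le (p q : M) : ‖diracMk o p - diracMk o q‖ ≤ dist p q :=
  norm_dirac_sub_le p q

theorem diracMk_base : diracMk o o = 0 := by
  apply toDual.injective
  ext g
  exact g.apply_base

theorem continuous_diracMk : Continuous (diracMk o) := by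
  refine (LipschitzWith.of_dist_le_mul (K := 1) fun p q => ?_).continuous
  rw [dist_eq_norm, NNReal.coe_one, one_mul]
  exact norm_diracMk_sub_le p q

/-- The Dirac functionals span a dense subspace: a closed subspace containing all of them is the
whole Lipschitz-free space. -/
theorem mem_of_diracMk_mem {p : Submodule ℝ (FreeBanach M o)}
    (hp : IsClosed (p : Set (FreeBanach M o))) (h : ∀ x, diracMk o x ∈ p) (μ : FreeBanach M o) :
    μ ∈ p := by
  have hspan : Submodule.span ℝ (Set.range (dirac o)) ≤ p.map toDual.toLinearMap := by
    rw [Submodule.span_le]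
    rintro _ ⟨x, rfl⟩
    exact ⟨diracMk o x, h x, rfl⟩
  have hcl : IsClosed (p.map (toDual (M := M) (o := o)).toLinearMap :
      Set (StrongDual ℝ (LipZero M o))) :=
    toDual.isometry.isClosedEmbedding.isClosedMap _ hp
  obtain ⟨ν, hν, hνμ⟩ := Submodule.topologicalClosure_minimal _ hspan hcl (toDual_mem μ)
  rwa [← toDual.injective hνμ]

theorem clm_ext {E : Type*} [NormedAddCommGroup E] [NormedSpace ℝ E]
    {S T : FreeBanach M o →L[ℝ] E} (h : ∀ x, S (diracMk o x) = T (diracMk o x)) : S = T := by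
  ext1 μ
  refine mem_of_diracMk_mem (p := LinearMap.eqLocus S.toLinearMap T.toLinearMap) ?_ h μ
  exact isClosed_eq S.continuous T.continuous

theorem dist_toDual_apply_le {Φ : M → FreeBanach N a} {L : ℝ}
    (hΦ : ∀ x y, ‖Φ x - Φ y‖ ≤ L * dist x y) (g : LipZero N a) (x y : M) :
    dist (toDual (Φ x) g) (toDual (Φ y) g) ≤ L * ‖g‖ * dist x y := by
  rw [Real.dist_eq, ← sub_apply, ← map_sub, ← Real.norm_eq_abs]
  refine ((toDual (Φ x - Φ y)).le_opNorm g).trans ?_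
  rw [toDual.norm_map]
  refine (mul_le_mul_of_nonneg_right (hΦ x y) (norm_nonneg g)).trans_eq ?_
  ring

/-- Composition with a Lipschitz map `Φ : M → F(N)` that vanishes at the base point, as a bounded
operator `Lip₀(N) → Lip₀(M)`; it sends `g` to `x ↦ Φ x g`. -/
def compDual (Φ : M → FreeBanach N a) (L : ℝ) (hL : 0 ≤ L)
    (hΦ : ∀ x y, ‖Φ x - Φ y‖ ≤ L * dist x y) (h0 : Φ o = 0) : LipZero N a →L[ℝ] LipZero M o :=
  LinearMap.mkContinuous
    { toFun := fun g => ⟨fun x => toDual (Φ x) g,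
        ⟨⟨Real.toNNReal (L * ‖g‖), LipschitzWith.of_dist_le_mul fun x y => by
          rw [Real.coe_toNNReal _ (by positivity)]
          exact dist_toDual_apply_le hΦ g x y⟩, by
          change toDual (Φ o) g = 0
          rw [h0, map_zero]
          rfl⟩⟩
      map_add' := fun f g => LipZero.ext fun x => map_add (toDual (Φ x)) f g
      map_smul' := fun c f => LipZero.ext fun x => map_smul (toDual (Φ x)) c f }
    L (fun g => LipZero.norm_le_of_forall _ (by positivity) (dist_toDual_apply_le hΦ g))

/-- The universal property of Lipschitz-free spaces, for targets that are themselves Lipschitz-free.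
The operator is the restriction of the adjoint of `compDual`, which maps Dirac functionals, and
hence the closure of their span, into `F(N)`. -/
theorem exists_lift (Φ : M → FreeBanach N a) {L : ℝ} (hL : 0 ≤ L)
    (hΦ : ∀ x y, ‖Φ x - Φ y‖ ≤ L * dist x y) (h0 : Φ o = 0) :
    ∃ T : FreeBanach M o →L[ℝ] FreeBanach N a, ‖T‖ ≤ L ∧ (∀ x, T (diracMk o x) = Φ x) ∧
      ∀ μ g, toDual (T μ) g = toDual μ (compDual Φ L hL hΦ h0 g) := by
  set E := compDual Φ L hL hΦ h0
  have hEn : ‖E‖ ≤ L := ContinuousLinearMap.opNorm_le_bound _ hL fun g =>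
    LipZero.norm_le_of_forall _ (by positivity) (dist_toDual_apply_le hΦ g)
  let A : StrongDual ℝ (LipZero M o) →L[ℝ] StrongDual ℝ (LipZero N a) :=
    (ContinuousLinearMap.compL ℝ (LipZero N a) (LipZero M o) ℝ).flip E
  have hmem (μ : FreeBanach M o) : A (toDual μ) ∈ FreeSpace N a := by
    refine mem_of_diracMk_mem (p := (FreeSpace N a).comap
      (A.comp toDual.toContinuousLinearMap).toLinearMap) ?_ (fun x => toDual_mem (Φ x)) μ
    exact isClosed_freeSpace.preimage (A.comp toDual.toContinuousLinearMap).continuous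
  let T : FreeBanach M o →ₗ[ℝ] FreeBanach N a :=
    { toFun := fun μ => mk (A (toDual μ)) (hmem μ)
      map_add' := fun μ ν => toDual.injective <| by simp
      map_smul' := fun c μ => toDual.injective <| by simp }
  have hT (μ : FreeBanach M o) : ‖T μ‖ ≤ L * ‖μ‖ := by
    change ‖(toDual μ).comp E‖ ≤ L * ‖μ‖
    refine (ContinuousLinearMap.opNorm_comp_le _ _).trans ?_
    rw [mul_comm, toDual.norm_map]
    exact mul_le_mul_of_nonneg_right hEn (norm_nonneg _)
  exact ⟨T.mkContinuous L hT, T.mkContinuous_norm_le hL hT, fun x => rfl, fun μ g => rfl⟩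

end FreeBanach

end Universal

open FreeBanach

/-! ### Free spaces of subsets -/

section Subset

variable {M : Type*} [MetricSpace M] {F : Set M}

/-- The Lipschitz-free space of a subset embeds isometrically, whatever the base points. That the
norm does not drop is McShane's extension theorem. -/
theorem exists_inclusion (a : F) (b : M) :
    ∃ J : FreeBanach F a →ₗᵢ[ℝ] FreeBanach M b,
      ∀ x : F, J (diracMk a x) = diracMk b (x : M) - diracMk b (a : M) := by
  have hΦ (x y : F) : ‖(diracMk b (x : M) - diracMk b (a : M)) -
      (diracMk b (y : M) - diracMk b (a : M))‖ ≤ 1 * dist x y := by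
    rw [sub_sub_sub_cancel_right, one_mul]
    exact norm_diracMk_sub_le _ _
  obtain ⟨T, hT, hTd, hTg⟩ := exists_lift (o := a)
    (fun x : F => diracMk b (x : M) - diracMk b (a : M)) zero_le_one hΦ (sub_self _)
  refine ⟨⟨T.toLinearMap, fun μ => le_antisymm ?_ ?_⟩, hTd⟩
  · simpa using T.le_of_opNorm_le hT μ
  refine ContinuousLinearMap.opNorm_le_bound (toDual μ) (norm_nonneg _) fun f => ?_
  have hf : LipschitzWith ‖f‖₊ (f : F → ℝ) := LipschitzWith.of_dist_le_mul f.dist_apply_le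
  classical
  have hf' : LipschitzOnWith ‖f‖₊ (fun x : M => if h : x ∈ F then f ⟨x, h⟩ else 0) F := by
    intro x hx y hy
    simp only [hx, hy, dif_pos]
    exact hf ⟨x, hx⟩ ⟨y, hy⟩
  obtain ⟨g, hg, hgf⟩ := hf'.extend_real
  have hg' : LipschitzWith ‖f‖₊ (fun x => g x - g b) := by
    refine LipschitzWith.of_dist_le_mul fun x y => ?_
    rw [dist_sub_right]
    exact hg.dist_le_mul x y
  let G : LipZero M b := ⟨fun x => g x - g b, ⟨‖f‖₊, hg'⟩, sub_self _⟩
  have hG : ‖G‖ ≤ ‖f‖ := LipZero.norm_le_of_forall _ (norm_nonneg f) hg'.dist_le_mul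
  have hfG : compDual (o := a) (fun x : F => diracMk b (x : M) - diracMk b (a : M)) 1 zero_le_one hΦ
      (sub_self _) G = f := by
    refine LipZero.ext fun x => ?_
    change (g x - g b) - (g a - g b) = f x
    rw [sub_sub_sub_cancel_right, ← hgf x.2, ← hgf a.2]
    simp
  rw [← hfG, ← hTg]
  refine ((toDual (T μ)).le_opNorm G).trans ?_
  rw [hfG]
  exact mul_le_mul_of_nonneg_left hG (norm_nonneg _)

/-- A Lipschitz map `Φ : M → F(F)` that extends the Dirac map of `F` gives a projection of `F(M)`
onto the copy of `F(F)`. -/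
theorem exists_retraction (a : F) (b : M) {L : ℝ} (hL : 0 ≤ L) (Φ : M → FreeBanach F a)
    (hΦ : ∀ x y, ‖Φ x - Φ y‖ ≤ L * dist x y) (hF : ∀ x : F, Φ x = diracMk a x) :
    ∃ (J : FreeBanach F a →ₗᵢ[ℝ] FreeBanach M b) (Q : FreeBanach M b →L[ℝ] FreeBanach F a),
      ‖Q‖ ≤ L ∧ ∀ μ, Q (J μ) = μ := by
  obtain ⟨J, hJ⟩ := exists_inclusion a b
  obtain ⟨Q, hQ, hQd, -⟩ := exists_lift (o := b) (fun x => Φ x - Φ b) hL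
    (fun x y => by rw [sub_sub_sub_cancel_right]; exact hΦ x y) (sub_self _)
  refine ⟨J, Q, hQ, fun μ => ?_⟩
  have : Q.comp J.toContinuousLinearMap = ContinuousLinearMap.id ℝ _ := by
    refine clm_ext fun x => ?_
    change Q (J _) = diracMk a x
    rw [hJ, map_sub, hQd, hQd, sub_sub_sub_cancel_right, hF, hF, diracMk_base, sub_zero]
  exact DFunLike.congr_fun this μ

end Subset

/-! ### The bounded approximation property -/

section Approximation

variable {X Y : Type*} [NormedAddCommGroup X] [NormedSpace ℝ X] [NormedAddCommGroup Y]
  [NormedSpace ℝ Y]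

theorem isometricToComplemented_of_leftInverse {c : ℝ} (J : X →ₗᵢ[ℝ] Y) (Q : Y →L[ℝ] X)
    (hQ : ‖Q‖ ≤ c) (hQJ : ∀ x, Q (J x) = x) : IsometricToComplemented c X Y := by
  refine ⟨J, J.toContinuousLinearMap.comp Q, fun y => ?_, ?_, ?_⟩
  · change J (Q (J (Q y))) = J (Q y)
    rw [hQJ]
  · ext y
    constructor
    · rintro ⟨z, rfl⟩
      exact ⟨Q z, rfl⟩
    · rintro ⟨x, rfl⟩
      exact ⟨J x, congrArg J (hQJ x)⟩
  · refine ContinuousLinearMap.opNorm_le_bound _ ((norm_nonneg Q).trans hQ) fun y => ?_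
    change ‖J (Q y)‖ ≤ c * ‖y‖
    rw [J.norm_map]
    exact Q.le_of_opNorm_le hQ y

theorem HasBAP.of_leftInverse {c C K : ℝ} (hY : HasBAP K Y) (J : X →ₗᵢ[ℝ] Y) (Q : Y →L[ℝ] X)
    (hQ : ‖Q‖ ≤ c) (hQJ : ∀ x, Q (J x) = x) (hC1 : 1 ≤ C) (hC : c * K ≤ C) : HasBAP C X := by
  have hc : 0 ≤ c := (norm_nonneg Q).trans hQ
  refine ⟨hC1, fun ε hε A hA => ?_⟩
  obtain ⟨S, hfin, hS, hSA⟩ := hY.2 (ε / (c + 1)) (by positivity) (J '' A)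
    (hA.image J.continuous)
  refine ⟨Q.comp (S.comp J.toContinuousLinearMap), ?_, ?_, fun x hx => ?_⟩
  · have : LinearMap.range (Q.comp (S.comp J.toContinuousLinearMap) : X →ₗ[ℝ] X) ≤
        (LinearMap.range (S : Y →ₗ[ℝ] Y)).map (Q : Y →ₗ[ℝ] X) := by
      rintro _ ⟨x, rfl⟩
      exact ⟨S (J x), ⟨J x, rfl⟩, rfl⟩
    exact Submodule.finiteDimensional_of_le this
  · refine ContinuousLinearMap.opNorm_le_bound _ (zero_le_one.trans hC1) fun x => ?_
    change ‖Q (S (J x))‖ ≤ C * ‖x‖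
    calc ‖Q (S (J x))‖ ≤ c * ‖S (J x)‖ := Q.le_of_opNorm_le hQ _
      _ ≤ c * (K * ‖J x‖) := mul_le_mul_of_nonneg_left (S.le_of_opNorm_le hS _) hc
      _ = c * K * ‖x‖ := by rw [J.norm_map]; ring
      _ ≤ C * ‖x‖ := mul_le_mul_of_nonneg_right hC (norm_nonneg x)
  · change ‖Q (S (J x)) - x‖ ≤ ε
    nth_rewrite 2 [← hQJ x]
    rw [← map_sub]
    calc ‖Q (S (J x) - J x)‖ ≤ c * ‖S (J x) - J x‖ := Q.le_of_opNorm_le hQ _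
      _ ≤ c * (ε / (c + 1)) := mul_le_mul_of_nonneg_left (hSA _ ⟨x, hx, rfl⟩) hc
      _ ≤ ε := by
        rw [mul_div_assoc', div_le_iff₀ (by positivity)]
        nlinarith

/-- For a bounded sequence of operators, convergence to the identity on Dirac functionals is enough
for the bounded approximation property. -/
theorem hasBAP_of_tendsto_diracMk {M : Type*} [MetricSpace M] {o : M} {c : ℝ} (hc : 1 ≤ c)
    (S : ℕ → FreeBanach M o →L[ℝ] FreeBanach M o) (hS : ∀ n, ‖S n‖ ≤ c)
    (hfin : ∀ n, FiniteDimensional ℝ (LinearMap.range (S n : FreeBanach M o →ₗ[ℝ] FreeBanach M o)))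
    (hlim : ∀ x, Tendsto (fun n => S n (diracMk o x)) atTop (𝓝 (diracMk o x))) :
    HasBAP c (FreeBanach M o) := by
  -- the estimate behind both the passage to the closure and the uniformity on compact sets
  have key (n : ℕ) (μ ν : FreeBanach M o) : ‖S n μ - μ‖ ≤ (c + 1) * ‖μ - ν‖ + ‖S n ν - ν‖ := by
    have h1 : S n μ - μ = S n (μ - ν) - (μ - ν) + (S n ν - ν) := by rw [map_sub]; abel
    rw [h1]
    refine (norm_add_le _ _).trans (add_le_add_left ((norm_sub_le _ _).trans ?_) _)
    rw [add_mul, one_mul]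
    exact add_le_add_left ((S n).le_of_opNorm_le (hS n) _) _
  let p : Submodule ℝ (FreeBanach M o) :=
    { carrier := {μ | Tendsto (fun n => S n μ) atTop (𝓝 μ)}
      add_mem' := fun {μ ν} hμ hν => by
        simpa only [Set.mem_ofPred_eq, map_add] using Tendsto.add hμ hν
      zero_mem' := by simp
      smul_mem' := fun r μ hμ => by
        simpa only [Set.mem_ofPred_eq, map_smul] using Tendsto.const_smul hμ r }
  have hp : IsClosed (p : Set (FreeBanach M o)) := by
    refine isClosed_of_closure_subset fun μ hμ => ?_
    change Tendsto (fun n => S n μ) atTop (𝓝 μ)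
    rw [Metric.tendsto_atTop]
    intro ε hε
    obtain ⟨ν, hν, hd⟩ := Metric.mem_closure_iff.1 hμ (ε / (2 * (c + 1))) (by positivity)
    obtain ⟨n₀, hn₀⟩ := (Metric.tendsto_atTop.1 hν) (ε / 2) (by positivity)
    refine ⟨n₀, fun n hn => ?_⟩
    have h1 := hn₀ n hn
    rw [dist_eq_norm] at hd h1 ⊢
    rw [lt_div_iff₀ (by positivity)] at hd
    linarith [key n μ ν]
  have hall (μ : FreeBanach M o) : Tendsto (fun n => S n μ) atTop (𝓝 μ) :=
    mem_of_diracMk_mem hp hlim μ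
  refine ⟨hc, fun ε hε K hK => ?_⟩
  obtain ⟨t, -, htfin, ht⟩ := hK.finite_cover_balls (e := ε / (2 * (c + 1))) (by positivity)
  have hev : ∀ᶠ n in atTop, ∀ ν ∈ t, dist (S n ν) ν < ε / 2 :=
    (eventually_all_finite htfin).2 fun ν _ => Metric.tendsto_nhds.1 (hall ν) _ (by positivity)
  obtain ⟨n, hn⟩ := hev.exists
  refine ⟨S n, hfin n, hS n, fun μ hμ => ?_⟩
  obtain ⟨ν, hν, hd⟩ := Set.mem_iUnion₂.1 (ht hμ)
  have h1 := hn ν hν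
  rw [Metric.mem_ball, dist_eq_norm, lt_div_iff₀ (by positivity)] at hd
  rw [dist_eq_norm] at h1
  linarith [key n μ ν]

end Approximation

/-! ### Gaussian densities and Gaussian means -/

section Gaussian

variable {V : Type*} [NormedAddCommGroup V] [InnerProductSpace ℝ V]

/-- The square root of the Gaussian probability density on `V` with centre `x` and variance
`1 / (2 * b)` in each direction. -/
def gaussRoot (b : ℝ) (x y : V) : ℝ :=
  (b / Real.pi) ^ (Module.finrank ℝ V / 4 : ℝ) * Real.exp (-(b / 2) * ‖y - x‖ ^ 2)

theorem gaussRoot_nonneg {b : ℝ} (hb : 0 < b) (x y : V) : 0 ≤ gaussRoot b x y := by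
  have := Real.pi_pos
  unfold gaussRoot
  positivity

theorem continuous_gaussRoot (b : ℝ) (x : V) : Continuous (gaussRoot b x) := by
  unfold gaussRoot
  fun_prop

theorem gaussRoot_sq {b : ℝ} (hb : 0 < b) (x y : V) : gaussRoot b x y ^ 2 =
    (b / Real.pi) ^ (Module.finrank ℝ V / 2 : ℝ) * Real.exp (-b * ‖y - x‖ ^ 2) := by
  have := Real.pi_pos
  rw [gaussRoot, mul_pow, ← Real.exp_nat_mul, ← Real.rpow_natCast (_ ^ _),
    ← Real.rpow_mul (by positivity)]
  congr 2 <;> push_cast <;> ring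

theorem gaussRoot_add (b : ℝ) (x y : V) : gaussRoot b x (y + x) = gaussRoot b 0 y := by
  simp [gaussRoot]

/-- A pointwise bound on `‖y - x‖ ^ 2` by a slowly growing exponential, from which the second
moment is estimated with the right dependence on the dimension. -/
theorem sq_norm_mul_gaussRoot_sq_le {b : ℝ} (hb : 0 < b) (hn : 0 < Module.finrank ℝ V) (x y : V) :
    ‖y - x‖ ^ 2 * gaussRoot b x y ^ 2 ≤ 2 * Module.finrank ℝ V / b *
      ((b / Real.pi) ^ (Module.finrank ℝ V / 2 : ℝ) *
        Real.exp (-(b * (1 - 1 / (2 * Module.finrank ℝ V))) * ‖y - x‖ ^ 2)) := by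
  have hpi := Real.pi_pos
  rw [gaussRoot_sq hb]
  set n := Module.finrank ℝ V
  have hn' : (0 : ℝ) < n := by exact_mod_cast hn
  have h1 : ‖y - x‖ ^ 2 ≤ 2 * n / b * Real.exp (b / (2 * n) * ‖y - x‖ ^ 2) := by
    have h2 := Real.add_one_le_exp (b / (2 * n) * ‖y - x‖ ^ 2)
    calc ‖y - x‖ ^ 2 = 2 * n / b * (b / (2 * n) * ‖y - x‖ ^ 2) := by field_simp
      _ ≤ _ := mul_le_mul_of_nonneg_left (by linarith) (by positivity)
  have h3 : -(b * (1 - 1 / (2 * n))) * ‖y - x‖ ^ 2 =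
      b / (2 * n) * ‖y - x‖ ^ 2 + -b * ‖y - x‖ ^ 2 := by
    field_simp
    ring
  rw [h3, Real.exp_add]
  refine (mul_le_mul_of_nonneg_right h1 (by positivity)).trans_eq ?_
  ring

variable [FiniteDimensional ℝ V] [MeasurableSpace V] [BorelSpace V]

theorem integrable_exp_neg_mul_sq_norm {b : ℝ} (hb : 0 < b) :
    Integrable fun v : V => Real.exp (-b * ‖v‖ ^ 2) := by
  by_contra h
  have h1 := GaussianFourier.integral_rexp_neg_mul_sq_norm (V := V) hb
  rw [integral_undef h] at h1
  have : 0 < (Real.pi / b) ^ (Module.finrank ℝ V / 2 : ℝ) :=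
    Real.rpow_pos_of_pos (div_pos Real.pi_pos hb) _
  exact this.ne h1

theorem integrable_gaussRoot_sq {b : ℝ} (hb : 0 < b) (x : V) :
    Integrable fun y => gaussRoot b x y ^ 2 := by
  simp_rw [gaussRoot_sq hb]
  exact ((integrable_exp_neg_mul_sq_norm hb).comp_sub_right x).const_mul _

theorem integral_gaussRoot_sq {b : ℝ} (hb : 0 < b) (x : V) : ∫ y, gaussRoot b x y ^ 2 = 1 := by
  have := Real.pi_pos
  simp_rw [gaussRoot_sq hb]
  rw [integral_const_mul,
    integral_sub_right_eq_self (fun y => Real.exp (-b * ‖y‖ ^ 2)) x,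
    GaussianFourier.integral_rexp_neg_mul_sq_norm hb,
    ← Real.mul_rpow (by positivity) (by positivity), div_mul_div_cancel₀ Real.pi_pos.ne',
    div_self hb.ne', Real.one_rpow]

theorem integrable_gaussRoot_mul {b c : ℝ} (hb : 0 < b) (hc : 0 < c) (x z : V) :
    Integrable fun y => gaussRoot b x y * gaussRoot c z y := by
  refine ((integrable_gaussRoot_sq hb x).add (integrable_gaussRoot_sq hc z)).mono'
    ((continuous_gaussRoot b x).mul (continuous_gaussRoot c z)).aestronglyMeasurable
    (Eventually.of_forall fun y => ?_)
  rw [Real.norm_of_nonneg (mul_nonneg (gaussRoot_nonneg hb x y) (gaussRoot_nonneg hc z y))]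
  have := gaussRoot_nonneg hb x y
  have := gaussRoot_nonneg hc z y
  simp only [Pi.add_apply]
  nlinarith [sq_nonneg (gaussRoot b x y - gaussRoot c z y)]

theorem integrable_gaussRoot_sub_sq {b c : ℝ} (hb : 0 < b) (hc : 0 < c) (x z : V) :
    Integrable fun y => (gaussRoot b x y - gaussRoot c z y) ^ 2 := by
  simp_rw [sub_sq, mul_assoc]
  exact ((integrable_gaussRoot_sq hb x).sub ((integrable_gaussRoot_mul hb hc x z).const_mul 2)).add
    (integrable_gaussRoot_sq hc z)

theorem integral_gaussRoot_sub_sq {b c : ℝ} (hb : 0 < b) (hc : 0 < c) (x z : V) :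
    ∫ y, (gaussRoot b x y - gaussRoot c z y) ^ 2 =
      2 - 2 * ∫ y, gaussRoot b x y * gaussRoot c z y := by
  have h := (integrable_gaussRoot_mul hb hc x z).const_mul 2
  simp_rw [sub_sq, mul_assoc]
  refine (integral_add ((integrable_gaussRoot_sq hb x).sub h)
    (integrable_gaussRoot_sq hc z)).trans ?_
  rw [integral_sub' (integrable_gaussRoot_sq hb x) h, integral_gaussRoot_sq hb,
    integral_gaussRoot_sq hc, integral_const_mul]
  ring

/-- The squared Hellinger distance of two translates of a Gaussian density. -/
theorem integral_gaussRoot_sub_sq_le_of_center {b : ℝ} (hb : 0 < b) (x z : V) :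
    ∫ y, (gaussRoot b x y - gaussRoot b z y) ^ 2 ≤ b / 2 * ‖x - z‖ ^ 2 := by
  -- by the parallelogram law, the product of the two roots is a multiple of the density centred
  -- at the midpoint
  have h (y : V) : gaussRoot b x y * gaussRoot b z y = Real.exp (-(b / 4) * ‖x - z‖ ^ 2) *
      gaussRoot b ((1 / 2 : ℝ) • (x + z)) y ^ 2 := by
    have hp := parallelogram_law_with_norm ℝ (y - x) (y - z)
    have h1 : y - x + (y - z) = (2 : ℝ) • (y - (1 / 2 : ℝ) • (x + z)) := by module
    have h2 : y - x - (y - z) = -(x - z) := by abel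
    rw [h1, h2, norm_neg, norm_smul, Real.norm_ofNat] at hp
    have hs : -(b / 2) * ‖y - x‖ ^ 2 + -(b / 2) * ‖y - z‖ ^ 2 = -(b / 4) * ‖x - z‖ ^ 2 +
        (-(b / 2) * ‖y - (1 / 2 : ℝ) • (x + z)‖ ^ 2 +
          -(b / 2) * ‖y - (1 / 2 : ℝ) • (x + z)‖ ^ 2) := by
      linear_combination (b / 4) * hp
    have he := congrArg Real.exp hs
    simp only [Real.exp_add] at he
    unfold gaussRoot
    linear_combination ((b / Real.pi) ^ (Module.finrank ℝ V / 4 : ℝ)) ^ 2 * he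
  rw [integral_gaussRoot_sub_sq hb hb]
  simp_rw [h]
  rw [integral_const_mul, integral_gaussRoot_sq hb]
  linarith [Real.add_one_le_exp (-(b / 4) * ‖x - z‖ ^ 2)]

/-- The squared Hellinger distance of two concentric Gaussian densities. -/
theorem integral_gaussRoot_sub_sq_le_of_scale {k d e : ℝ} (hk : 0 < k) (hd : 0 < d) (he : 0 < e)
    (x : V) :
    ∫ y, (gaussRoot (k / d ^ 2) x y - gaussRoot (k / e ^ 2) x y) ^ 2 ≤
      2 * Module.finrank ℝ V * ((d - e) ^ 2 / (d ^ 2 + e ^ 2)) := by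
  have hpi := Real.pi_pos
  have hb : 0 < k / d ^ 2 := by positivity
  have hc : 0 < k / e ^ 2 := by positivity
  set n := Module.finrank ℝ V with hn
  set z : ℝ := 2 * d * e / (d ^ 2 + e ^ 2) with hz
  have hz0 : 0 < z := by positivity
  have hz1 : z = 1 + (-((d - e) ^ 2 / (d ^ 2 + e ^ 2))) := by
    rw [hz]
    field_simp
    ring
  have hzle : z ≤ 1 := by
    rw [hz1]
    have : 0 ≤ (d - e) ^ 2 / (d ^ 2 + e ^ 2) := by positivity
    linarith
  have hbase : (k / d ^ 2 / Real.pi) ^ (1 / 2 : ℝ) * (k / e ^ 2 / Real.pi) ^ (1 / 2 : ℝ) *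
      (Real.pi / ((k / d ^ 2 + k / e ^ 2) / 2)) = z := by
    rw [← Real.sqrt_eq_rpow, ← Real.sqrt_eq_rpow, ← Real.sqrt_mul (by positivity)]
    have : k / d ^ 2 / Real.pi * (k / e ^ 2 / Real.pi) = (k / (d * e * Real.pi)) ^ 2 := by
      field_simp
    rw [this, Real.sqrt_sq (by positivity), hz]
    field_simp
    ring
  have hI : ∫ y, gaussRoot (k / d ^ 2) x y * gaussRoot (k / e ^ 2) x y = z ^ (n / 2 : ℝ) := by
    have h (y : V) : gaussRoot (k / d ^ 2) x y * gaussRoot (k / e ^ 2) x y =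
        ((k / d ^ 2 / Real.pi) ^ (n / 4 : ℝ) * (k / e ^ 2 / Real.pi) ^ (n / 4 : ℝ)) *
          Real.exp (-((k / d ^ 2 + k / e ^ 2) / 2) * ‖y - x‖ ^ 2) := by
      have hs : -((k / d ^ 2 + k / e ^ 2) / 2) * ‖y - x‖ ^ 2 =
        -(k / d ^ 2 / 2) * ‖y - x‖ ^ 2 + -(k / e ^ 2 / 2) * ‖y - x‖ ^ 2 := by ring
      rw [hs, Real.exp_add]
      unfold gaussRoot
      ring
    simp_rw [h]
    rw [integral_const_mul, integral_sub_right_eq_self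
      (fun y => Real.exp (-((k / d ^ 2 + k / e ^ 2) / 2) * ‖y‖ ^ 2)) x,
      GaussianFourier.integral_rexp_neg_mul_sq_norm (by positivity), ← hbase,
      Real.mul_rpow (by positivity) (by positivity), Real.mul_rpow (by positivity) (by positivity),
      ← Real.rpow_mul (by positivity), ← Real.rpow_mul (by positivity)]
    congr 3 <;> ring_nf
  -- `n / 2` may be smaller than `1`, so Bernoulli's inequality is applied with exponent `n`
  have hbern : 1 - n * ((d - e) ^ 2 / (d ^ 2 + e ^ 2)) ≤ z ^ (n / 2 : ℝ) := by
    calc 1 - n * ((d - e) ^ 2 / (d ^ 2 + e ^ 2))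
        = 1 + n * (-((d - e) ^ 2 / (d ^ 2 + e ^ 2))) := by ring
      _ ≤ z ^ n := by
        rw [hz1]
        exact one_add_mul_le_pow (by linarith) n
      _ = z ^ (n : ℝ) := (Real.rpow_natCast z n).symm
      _ ≤ z ^ (n / 2 : ℝ) := Real.rpow_le_rpow_of_exponent_ge hz0 hzle
        (half_le_self (Nat.cast_nonneg n))
  rw [integral_gaussRoot_sub_sq hb hc, hI]
  linarith

theorem integrable_sq_norm_mul_gaussRoot_sq_bound {b : ℝ} (hb : 0 < b)
    (hn : 0 < Module.finrank ℝ V) (x : V) :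
    Integrable fun y => 2 * Module.finrank ℝ V / b *
      ((b / Real.pi) ^ (Module.finrank ℝ V / 2 : ℝ) *
        Real.exp (-(b * (1 - 1 / (2 * Module.finrank ℝ V))) * ‖y - x‖ ^ 2)) := by
  have hn' : (1 : ℝ) ≤ Module.finrank ℝ V := by exact_mod_cast hn
  have hpos : 0 < b * (1 - 1 / (2 * Module.finrank ℝ V) : ℝ) := by
    refine mul_pos hb (sub_pos.2 ?_)
    rw [div_lt_one (by linarith)]
    linarith
  exact (((integrable_exp_neg_mul_sq_norm hpos).comp_sub_right x).const_mul _).const_mul _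

theorem integrable_sq_norm_mul_gaussRoot_sq {b : ℝ} (hb : 0 < b) (hn : 0 < Module.finrank ℝ V)
    (x : V) : Integrable fun y => ‖y - x‖ ^ 2 * gaussRoot b x y ^ 2 := by
  refine (integrable_sq_norm_mul_gaussRoot_sq_bound hb hn x).mono' ?_
    (Eventually.of_forall fun y => ?_)
  · have := continuous_gaussRoot b x
    exact Continuous.aestronglyMeasurable (by fun_prop)
  · rw [Real.norm_of_nonneg (by positivity)]
    exact sq_norm_mul_gaussRoot_sq_le hb hn x y

theorem integral_sq_norm_mul_gaussRoot_sq_le {b : ℝ} (hb : 0 < b) (hn : 0 < Module.finrank ℝ V)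
    (x : V) : ∫ y, ‖y - x‖ ^ 2 * gaussRoot b x y ^ 2 ≤ 4 * Module.finrank ℝ V / b := by
  have hpi := Real.pi_pos
  have hn' : (1 : ℝ) ≤ Module.finrank ℝ V := by exact_mod_cast hn
  refine (integral_mono_of_nonneg (Eventually.of_forall fun y => by positivity)
    (integrable_sq_norm_mul_gaussRoot_sq_bound hb hn x)
    (Eventually.of_forall (sq_norm_mul_gaussRoot_sq_le hb hn x))).trans ?_
  set n := Module.finrank ℝ V with hdef
  set q : ℝ := 1 - 1 / (2 * n) with hq
  have hq1 : q ≤ 1 := by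
    have : (0 : ℝ) ≤ 1 / (2 * n) := by positivity
    linarith
  have hq0 : 1 / 2 ≤ q := by
    have : 1 / (2 * (n : ℝ)) ≤ 1 / 2 := by
      apply one_div_le_one_div_of_le <;> linarith
    linarith
  have hqpow : 1 / 2 ≤ q ^ (n / 2 : ℝ) := by
    calc (1 / 2 : ℝ) = 1 + n * (-(1 / (2 * n))) := by field_simp; norm_num
      _ ≤ (1 + -(1 / (2 * n))) ^ n := one_add_mul_le_pow (by linarith) n
      _ = q ^ (n : ℝ) := by rw [Real.rpow_natCast, hq, sub_eq_add_neg]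
      _ ≤ q ^ (n / 2 : ℝ) := Real.rpow_le_rpow_of_exponent_ge (by linarith) hq1
        (half_le_self (Nat.cast_nonneg n))
  have hq0' : 0 < q := by linarith
  rw [integral_const_mul, integral_const_mul,
    integral_sub_right_eq_self (fun y : V => Real.exp (-(b * q) * ‖y‖ ^ 2)) x,
    GaussianFourier.integral_rexp_neg_mul_sq_norm (by positivity), ← hdef,
    ← Real.mul_rpow (by positivity) (by positivity)]
  have h1 : b / Real.pi * (Real.pi / (b * q)) = q⁻¹ := by field_simp
  rw [h1, Real.inv_rpow hq0'.le]
  have h2 : (q ^ (n / 2 : ℝ))⁻¹ ≤ 2 := by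
    rw [inv_le_comm₀ (by positivity) two_pos]
    simpa using hqpow
  calc 2 * n / b * (q ^ (n / 2 : ℝ))⁻¹ ≤ 2 * n / b * 2 :=
        mul_le_mul_of_nonneg_left h2 (by positivity)
    _ = 4 * n / b := by ring

/-- Second moments with an affine weight, and with respect to a shifted centre. -/
theorem integral_affine_sq_mul_gaussRoot_sq {b : ℝ} (hb : 0 < b) (hn : 0 < Module.finrank ℝ V)
    (x z : V) (α β : ℝ) :
    Integrable (fun y => (α + β * ‖y - z‖) ^ 2 * gaussRoot b x y ^ 2) ∧
      ∫ y, (α + β * ‖y - z‖) ^ 2 * gaussRoot b x y ^ 2 ≤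
        2 * α ^ 2 + 2 * β ^ 2 * (8 * Module.finrank ℝ V / b + 2 * ‖x - z‖ ^ 2) := by
  have hI1 := (integrable_gaussRoot_sq hb x).const_mul (2 * α ^ 2 + 4 * β ^ 2 * ‖x - z‖ ^ 2)
  have hI2 := (integrable_sq_norm_mul_gaussRoot_sq hb hn x).const_mul (4 * β ^ 2)
  have hle (y : V) : (α + β * ‖y - z‖) ^ 2 * gaussRoot b x y ^ 2 ≤
      (2 * α ^ 2 + 4 * β ^ 2 * ‖x - z‖ ^ 2) * gaussRoot b x y ^ 2 +
        4 * β ^ 2 * (‖y - x‖ ^ 2 * gaussRoot b x y ^ 2) := by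
    have h1 : ‖y - z‖ ≤ ‖y - x‖ + ‖x - z‖ := norm_sub_le_norm_sub_add_norm_sub _ _ _
    have h2 : ‖y - z‖ ^ 2 ≤ 2 * ‖y - x‖ ^ 2 + 2 * ‖x - z‖ ^ 2 := by
      have := norm_nonneg (y - z)
      nlinarith [sq_nonneg (‖y - x‖ - ‖x - z‖)]
    have h3 : (α + β * ‖y - z‖) ^ 2 ≤ 2 * α ^ 2 + 2 * β ^ 2 * ‖y - z‖ ^ 2 := by
      nlinarith [sq_nonneg (α - β * ‖y - z‖)]
    have h4 : (α + β * ‖y - z‖) ^ 2 ≤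
        2 * α ^ 2 + 4 * β ^ 2 * ‖x - z‖ ^ 2 + 4 * β ^ 2 * ‖y - x‖ ^ 2 := by
      nlinarith [mul_le_mul_of_nonneg_left h2 (sq_nonneg β)]
    refine (mul_le_mul_of_nonneg_right h4 (sq_nonneg _)).trans_eq ?_
    ring
  constructor
  · refine (hI1.add hI2).mono' ?_ (Eventually.of_forall fun y => ?_)
    · have := continuous_gaussRoot b x
      exact Continuous.aestronglyMeasurable (by fun_prop)
    · rw [Real.norm_of_nonneg (by positivity)]
      exact hle y
  · refine (integral_mono_of_nonneg (Eventually.of_forall fun y => by positivity) (hI1.add hI2)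
      (Eventually.of_forall hle)).trans ?_
    rw [integral_add' hI1 hI2, integral_const_mul, integral_const_mul, integral_gaussRoot_sq hb]
    have := mul_le_mul_of_nonneg_left (integral_sq_norm_mul_gaussRoot_sq_le hb hn x)
      (sq_nonneg β)
    linear_combination 4 * this

variable {E : Type*} [NormedAddCommGroup E] [NormedSpace ℝ E]

/-- The mean of a vector-valued function with respect to the Gaussian density
`gaussRoot b x ^ 2`. -/
def gaussMean (b : ℝ) (x : V) (v : V → E) : E := ∫ y, gaussRoot b x y ^ 2 • v y

theorem integrable_gaussRoot_sq_smul {b : ℝ} (hb : 0 < b) (hn : 0 < Module.finrank ℝ V)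
    {v : V → E} (hv : StronglyMeasurable v) {α β : ℝ} {z : V}
    (hw : ∀ y, ‖v y‖ ≤ α + β * ‖y - z‖) (x : V) :
    Integrable fun y => gaussRoot b x y ^ 2 • v y := by
  have hI := (integrable_gaussRoot_sq hb x).add
    (integral_affine_sq_mul_gaussRoot_sq hb hn x z α β).1
  refine hI.mono' (((continuous_gaussRoot b x).pow 2).aestronglyMeasurable.smul
    hv.aestronglyMeasurable) (Eventually.of_forall fun y => ?_)
  rw [norm_smul, Real.norm_of_nonneg (sq_nonneg _)]
  have h1 : ‖v y‖ ≤ 1 + (α + β * ‖y - z‖) ^ 2 := by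
    nlinarith [hw y, sq_nonneg (α + β * ‖y - z‖ - 1)]
  have h2 := mul_le_mul_of_nonneg_left h1 (sq_nonneg (gaussRoot b x y))
  simp only [Pi.add_apply]
  linarith

theorem gaussMean_sub_const [CompleteSpace E] {b : ℝ} (hb : 0 < b) {x : V} {v : V → E}
    (hv : Integrable fun y => gaussRoot b x y ^ 2 • v y) (e : E) :
    gaussMean b x (fun y => v y - e) = gaussMean b x v - e := by
  simp_rw [gaussMean, smul_sub]
  rw [integral_sub hv ((integrable_gaussRoot_sq hb x).smul_const e), integral_smul_const,
    integral_gaussRoot_sq hb, one_smul]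

/-- A Gaussian mean of a function of affine growth, in terms of a free scale parameter `t`. -/
theorem norm_gaussMean_le {b : ℝ} (hb : 0 < b) (hn : 0 < Module.finrank ℝ V) {v : V → E}
    {α β : ℝ} (hβ : 0 ≤ β) {x : V} (hw : ∀ y, ‖v y‖ ≤ α + β * ‖y - x‖) {t : ℝ} (ht : 0 < t) :
    ‖gaussMean b x v‖ ≤ α + β * (t + 4 * Module.finrank ℝ V / b / t) := by
  have hI1 := (integrable_gaussRoot_sq hb x).const_mul (α + β * t)
  have hI2 := (integrable_sq_norm_mul_gaussRoot_sq hb hn x).const_mul (β / t)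
  refine (norm_integral_le_of_norm_le (hI1.add hI2) (Eventually.of_forall fun y => ?_)).trans ?_
  · rw [norm_smul, Real.norm_of_nonneg (sq_nonneg _)]
    have h1 : ‖y - x‖ ≤ t + ‖y - x‖ ^ 2 / t := by
      rw [← sub_le_iff_le_add', le_div_iff₀ ht]
      nlinarith [sq_nonneg (‖y - x‖ - t)]
    have h2 : ‖v y‖ ≤ (α + β * t) + β / t * ‖y - x‖ ^ 2 := by
      refine (hw y).trans ?_
      have := mul_le_mul_of_nonneg_left h1 hβ
      calc α + β * ‖y - x‖ ≤ α + β * (t + ‖y - x‖ ^ 2 / t) := by linarith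
        _ = _ := by ring
    refine (mul_le_mul_of_nonneg_left h2 (sq_nonneg _)).trans_eq ?_
    simp only [Pi.add_apply]
    ring
  · rw [integral_add' hI1 hI2, integral_const_mul, integral_const_mul, integral_gaussRoot_sq hb]
    have := mul_le_mul_of_nonneg_left (integral_sq_norm_mul_gaussRoot_sq_le hb hn x)
      (div_nonneg hβ ht.le)
    calc _ ≤ (α + β * t) * 1 + β / t * (4 * Module.finrank ℝ V / b) := by linarith
      _ = _ := by ring

/-- Comparison of two Gaussian means. It is the Cauchy–Schwarz inequality for the factorization
`p ^ 2 - q ^ 2 = (p - q) * (p + q)`, in the form with a free parameter `τ`. -/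
theorem norm_gaussMean_sub_le {b c : ℝ} (hb : 0 < b) (hc : 0 < c) (hn : 0 < Module.finrank ℝ V)
    {v : V → E} (hv : StronglyMeasurable v) {α β : ℝ} {u : V}
    (hw : ∀ y, ‖v y‖ ≤ α + β * ‖y - u‖) (x z : V) {τ H A B : ℝ} (hτ : 0 < τ)
    (hH : ∫ y, (gaussRoot b x y - gaussRoot c z y) ^ 2 ≤ H)
    (hA : 2 * α ^ 2 + 2 * β ^ 2 * (8 * Module.finrank ℝ V / b + 2 * ‖x - u‖ ^ 2) ≤ A)
    (hB : 2 * α ^ 2 + 2 * β ^ 2 * (8 * Module.finrank ℝ V / c + 2 * ‖z - u‖ ^ 2) ≤ B) :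
    ‖gaussMean b x v - gaussMean c z v‖ ≤ H / (2 * τ) + τ * (A + B) := by
  obtain ⟨hIA, hA'⟩ := integral_affine_sq_mul_gaussRoot_sq hb hn x u α β
  obtain ⟨hIB, hB'⟩ := integral_affine_sq_mul_gaussRoot_sq hc hn z u α β
  have hIH := (integrable_gaussRoot_sub_sq hb hc x z).const_mul (1 / (2 * τ))
  have hIW := (hIA.add hIB).const_mul τ
  rw [gaussMean, gaussMean, ← integral_sub (integrable_gaussRoot_sq_smul hb hn hv hw x)
    (integrable_gaussRoot_sq_smul hc hn hv hw z)]
  refine (norm_integral_le_of_norm_le (hIH.add hIW) (Eventually.of_forall fun y => ?_)).trans ?_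
  · rw [← sub_smul, norm_smul, Real.norm_eq_abs]
    set p := gaussRoot b x y
    set q := gaussRoot c z y
    set w := α + β * ‖y - u‖
    have hw0 : 0 ≤ w := (norm_nonneg _).trans (hw y)
    have h1 : |p ^ 2 - q ^ 2| * ‖v y‖ ≤ |p - q| * (w * |p + q|) := by
      rw [sq_sub_sq, abs_mul]
      calc |p + q| * |p - q| * ‖v y‖ ≤ |p + q| * |p - q| * w :=
            mul_le_mul_of_nonneg_left (hw y) (by positivity)
        _ = _ := by ring
    have h2 : |p - q| * (w * |p + q|) ≤ 1 / (2 * τ) * |p - q| ^ 2 + τ / 2 * (w * |p + q|) ^ 2 := by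
      have h3 : 1 / (2 * τ) * |p - q| ^ 2 + τ / 2 * (w * |p + q|) ^ 2 - |p - q| * (w * |p + q|) =
          1 / (2 * τ) * (|p - q| - τ * (w * |p + q|)) ^ 2 := by
        field_simp
        ring
      have h4 : 0 ≤ 1 / (2 * τ) * (|p - q| - τ * (w * |p + q|)) ^ 2 := by positivity
      linarith
    have h5 : τ / 2 * (w * |p + q|) ^ 2 ≤ τ * (w ^ 2 * p ^ 2 + w ^ 2 * q ^ 2) := by
      rw [mul_pow, sq_abs]
      have : (p + q) ^ 2 ≤ 2 * (p ^ 2 + q ^ 2) := by nlinarith [sq_nonneg (p - q)]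
      nlinarith [mul_le_mul_of_nonneg_left this (show 0 ≤ τ / 2 * w ^ 2 by positivity)]
    rw [sq_abs] at h2
    exact h1.trans (h2.trans (add_le_add_right h5 _))
  · rw [integral_add' hIH hIW, integral_const_mul, integral_const_mul, integral_add' hIA hIB]
    refine add_le_add ?_
      (mul_le_mul_of_nonneg_left (add_le_add (hA'.trans hA) (hB'.trans hB)) hτ.le)
    rw [one_div_mul_eq_div]
    exact div_le_div_of_nonneg_right hH (by positivity)

end Gaussian

/-! ### Lipschitz extension of the Dirac map -/

section Extension

/-- A measurable choice of almost nearest points in a closed set. The bound forces `r y = y` for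
`y ∈ F`. -/
theorem exists_measurable_almost_nearest {V : Type*} [MetricSpace V] [SecondCountableTopology V]
    [MeasurableSpace V] [BorelSpace V] {F : Set V} (hF : IsClosed F) (hne : F.Nonempty) :
    ∃ r : V → F, Measurable r ∧ ∀ y : V, dist y (r y) ≤ 2 * Metric.infDist y F := by
  classical
  have := hne.to_subtype
  let u := TopologicalSpace.denseSeq F
  let p (y : V) (n : ℕ) : Prop := y ∈ F ∨ dist y (u n) ≤ 2 * Metric.infDist y F
  have hp (y : V) : ∃ n, p y n := by
    by_cases hy : y ∈ F
    · exact ⟨0, Or.inl hy⟩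
    have hpos := (hF.notMem_iff_infDist_pos hne).1 hy
    obtain ⟨z, hzF, hz⟩ := (Metric.infDist_lt_iff (x := y) hne).1
      (show Metric.infDist y F < 2 * Metric.infDist y F by linarith)
    have hopen : IsOpen {q : F | dist y q < 2 * Metric.infDist y F} :=
      isOpen_lt (continuous_const.dist continuous_subtype_val) continuous_const
    obtain ⟨n, hn⟩ := (TopologicalSpace.denseRange_denseSeq F).exists_mem_open hopen ⟨⟨z, hzF⟩, hz⟩
    exact ⟨n, Or.inr hn.le⟩
  have hfind : Measurable fun y => Nat.find (hp y) := by
    refine measurable_find hp fun n => hF.measurableSet.union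
      (s₂ := {y : V | dist y (u n) ≤ 2 * Metric.infDist y F}) ?_
    exact measurableSet_le (by fun_prop) (by fun_prop)
  let g (y : V) : V := if y ∈ F then y else u (Nat.find (hp y))
  have hg : Measurable g := Measurable.ite hF.measurableSet measurable_id
    (measurable_subtype_coe.comp ((measurable_of_countable u).comp hfind))
  have hgF (y : V) : g y ∈ F := by
    by_cases hy : y ∈ F
    · simp [g, hy]
    · simp [g, hy]
  refine ⟨fun y => ⟨g y, hgF y⟩, hg.subtype_mk, fun y => ?_⟩
  by_cases hy : y ∈ F
  · simp [g, hy, Metric.infDist_nonneg]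
  · simpa [g, hy] using (Nat.find_spec (hp y)).resolve_left hy

theorem dist_almost_nearest_le {V : Type*} [NormedAddCommGroup V] {F : Set V} {r : V → F}
    (hr : ∀ y : V, dist y (r y) ≤ 2 * Metric.infDist y F) (x y : V) :
    dist (r y) (r x) ≤ 4 * Metric.infDist x F + 3 * ‖y - x‖ := by
  have h1 : Metric.infDist y F ≤ Metric.infDist x F + dist y x := Metric.infDist_le_infDist_add_dist
  have h2 : dist (r y : V) (r x) ≤ dist (r y : V) y + dist y x + dist x (r x) :=
    dist_triangle4 _ _ _ _
  rw [dist_comm (r y : V) y] at h2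
  rw [← dist_eq_norm]
  change dist (r y : V) (r x) ≤ _
  linarith [hr x, hr y]

variable {V : Type*} [NormedAddCommGroup V] [InnerProductSpace ℝ V] [FiniteDimensional ℝ V]
  [MeasurableSpace V] [BorelSpace V] {F : Set V} {a : F}

open Classical in
/-- The extension of the Dirac map of `F` that averages the Dirac functionals at almost nearest
points `r y`, for `y` Gaussian with mean `x` and expected squared distance to `x` equal to
`infDist x F ^ 2 / 2`. -/
def gaussExtension (a : F) (r : V → F) (x : V) : FreeBanach F a :=
  if h : x ∈ F then diracMk a ⟨x, h⟩
  else gaussMean (Module.finrank ℝ V / Metric.infDist x F ^ 2) x fun y => diracMk a (r y)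

theorem stronglyMeasurable_diracMk_comp {r : V → F} (hr : Measurable r) :
    StronglyMeasurable fun y => diracMk a (r y) :=
  continuous_diracMk.comp_stronglyMeasurable hr.stronglyMeasurable

/-- The second moment of the Gaussian at `x` is of order `infDist x F ^ 2`, whatever the
dimension. -/
theorem norm_gaussExtension_sub_le (hF : IsClosed F) (hn : 0 < Module.finrank ℝ V) {r : V → F}
    (hrm : Measurable r) (hr : ∀ y : V, dist y (r y) ≤ 2 * Metric.infDist y F) (x : V) :
    ‖gaussExtension a r x - diracMk a (r x)‖ ≤ 16 * Metric.infDist x F := by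
  by_cases hx : x ∈ F
  · have h := hr x
    rw [Metric.infDist_zero_of_mem hx, mul_zero] at h
    have h1 : r x = ⟨x, hx⟩ := Subtype.ext (dist_le_zero.1 h).symm
    rw [gaussExtension, dif_pos hx, h1, sub_self, norm_zero]
    exact mul_nonneg (by norm_num) Metric.infDist_nonneg
  · have hd := (hF.notMem_iff_infDist_pos ⟨a, a.2⟩).1 hx
    rw [gaussExtension, dif_neg hx]
    have hn' : (0 : ℝ) < Module.finrank ℝ V := by exact_mod_cast hn
    have hw (y : V) : ‖diracMk a (r y) - diracMk a (r x)‖ ≤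
        4 * Metric.infDist x F + 3 * ‖y - x‖ :=
      (norm_diracMk_sub_le _ _).trans (dist_almost_nearest_le hr x y)
    have hv := (stronglyMeasurable_diracMk_comp (a := a) hrm).sub
      (stronglyMeasurable_const (b := diracMk a (r x)))
    set d := Metric.infDist x F
    have hb : 0 < Module.finrank ℝ V / d ^ 2 := by positivity
    have hI : Integrable fun y => gaussRoot (Module.finrank ℝ V / d ^ 2) x y ^ 2 •
        diracMk a (r y) := by
      refine integrable_gaussRoot_sq_smul hb hn (stronglyMeasurable_diracMk_comp hrm)
        (α := ‖diracMk a (r x)‖ + 4 * d) (β := 3) (z := x) (fun y => ?_) x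
      have := norm_le_norm_add_norm_sub' (diracMk a (r y)) (diracMk a (r x))
      linarith [hw y]
    rw [← gaussMean_sub_const hb hI]
    refine (norm_gaussMean_le hb hn (by norm_num) hw (t := 2 * d) (by positivity)).trans_eq ?_
    field_simp
    ring

theorem norm_gaussExtension_sub_gaussExtension_le (hF : IsClosed F) (hn : 0 < Module.finrank ℝ V)
    {r : V → F} (hrm : Measurable r) (hr : ∀ y : V, dist y (r y) ≤ 2 * Metric.infDist y F)
    (x z : V) :
    ‖gaussExtension a r x - gaussExtension a r z‖ ≤
      1000 * Real.sqrt (Module.finrank ℝ V) * dist x z := by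
  rcases eq_or_ne x z with rfl | hxz
  · simp
  have ht : 0 < dist x z := dist_pos.2 hxz
  have hn1 : (1 : ℝ) ≤ Module.finrank ℝ V := by exact_mod_cast hn
  have hs1 : 1 ≤ Real.sqrt (Module.finrank ℝ V) := Real.one_le_sqrt.2 hn1
  have hss : Real.sqrt (Module.finrank ℝ V) ^ 2 = Module.finrank ℝ V := Real.sq_sqrt (by linarith)
  have hex : Metric.infDist z F ≤ Metric.infDist x F + dist x z := by
    rw [dist_comm]
    exact Metric.infDist_le_infDist_add_dist
  have hex' : Metric.infDist x F ≤ Metric.infDist z F + dist x z :=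
    Metric.infDist_le_infDist_add_dist
  have hx := norm_gaussExtension_sub_le (a := a) hF hn hrm hr x
  have hz := norm_gaussExtension_sub_le (a := a) hF hn hrm hr z
  have hw (y : V) : ‖diracMk a (r y) - diracMk a (r x)‖ ≤
      4 * Metric.infDist x F + 3 * ‖y - x‖ :=
    (norm_diracMk_sub_le _ _).trans (dist_almost_nearest_le hr x y)
  have hwz := hw z
  rw [← dist_eq_norm z x, dist_comm] at hwz
  rcases le_or_gt (Metric.infDist x F) (2 * dist x z) with hfar | hnear
  · -- both points are so close to `F` that comparison with the almost nearest points suffices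
    have h1 : gaussExtension a r x - gaussExtension a r z =
        (gaussExtension a r x - diracMk a (r x)) - (gaussExtension a r z - diracMk a (r z)) -
          (diracMk a (r z) - diracMk a (r x)) := by abel
    have h2 : ‖gaussExtension a r x - gaussExtension a r z‖ ≤ 91 * dist x z := by
      rw [h1]
      refine (norm_sub_le _ _).trans ((add_le_add_left (norm_sub_le _ _) _).trans ?_)
      linarith
    refine h2.trans (mul_le_mul_of_nonneg_right ?_ ht.le)
    linarith
  · -- the centre and then the variance are changed, each at the cost of a Hellinger distance
    have hd : 0 < Metric.infDist x F := by linarith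
    have he : 0 < Metric.infDist z F := by linarith
    have hxF : x ∉ F := (hF.notMem_iff_infDist_pos ⟨a, a.2⟩).2 hd
    have hzF : z ∉ F := (hF.notMem_iff_infDist_pos ⟨a, a.2⟩).2 he
    set n : ℝ := (Module.finrank ℝ V : ℝ) with hn_def
    set s := Real.sqrt n
    set d := Metric.infDist x F
    set e := Metric.infDist z F
    set t := dist x z with ht_def
    have hb : 0 < n / d ^ 2 := by positivity
    have hc : 0 < n / e ^ 2 := by positivity
    let v (y : V) : FreeBanach F a := diracMk a (r y) - diracMk a (r x)
    have hv : StronglyMeasurable v := (stronglyMeasurable_diracMk_comp hrm).sub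
      stronglyMeasurable_const
    have hI (b : ℝ) (hb : 0 < b) (q : V) :
        Integrable fun y => gaussRoot b q y ^ 2 • diracMk a (r y) := by
      refine integrable_gaussRoot_sq_smul hb hn (stronglyMeasurable_diracMk_comp hrm)
        (α := ‖diracMk a (r x)‖ + 4 * d) (β := 3) (z := x) (fun y => ?_) q
      have := norm_le_norm_add_norm_sub' (diracMk a (r y)) (diracMk a (r x))
      linarith [hw y]
    have hsplit : gaussExtension a r x - gaussExtension a r z =
        (gaussMean (n / d ^ 2) x v - gaussMean (n / d ^ 2) z v) +
          (gaussMean (n / d ^ 2) z v - gaussMean (n / e ^ 2) z v) := by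
      rw [sub_add_sub_cancel, gaussExtension, gaussExtension, dif_neg hxF, dif_neg hzF,
        gaussMean_sub_const hb (hI _ hb x), gaussMean_sub_const hc (hI _ hc z),
        sub_sub_sub_cancel_right]
    have htd : t ^ 2 ≤ d ^ 2 / 4 := by nlinarith
    have hed : e ^ 2 ≤ 9 / 4 * d ^ 2 := by nlinarith
    have hzx : ‖z - x‖ = t := by rw [← dist_eq_norm, dist_comm]
    have hbn : 8 * n / (n / d ^ 2) = 8 * d ^ 2 := by field_simp
    have hcn : 8 * n / (n / e ^ 2) = 8 * e ^ 2 := by field_simp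
    -- the parameter balances a squared Hellinger distance of order `n * t ^ 2 / d ^ 2` against
    -- second moments of order `d ^ 2`
    have hτ : 0 < s * t / d ^ 2 := by positivity
    have h1 := norm_gaussMean_sub_le hb hb hn hv hw x z hτ
      (integral_gaussRoot_sub_sq_le_of_center hb x z) (A := 176 * d ^ 2) (B := 185 * d ^ 2)
      (by rw [← hn_def, hbn, sub_self, norm_zero]; nlinarith)
      (by rw [← hn_def, hbn, hzx]; nlinarith)
    have hH : 2 * n * ((d - e) ^ 2 / (d ^ 2 + e ^ 2)) ≤ 2 * n * (t ^ 2 / d ^ 2) := by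
      refine mul_le_mul_of_nonneg_left ?_ (by positivity)
      refine div_le_div₀ (sq_nonneg t) ?_ (by positivity) (by nlinarith)
      refine sq_le_sq' ?_ ?_ <;> linarith
    have h2 := norm_gaussMean_sub_le hb hc hn hv hw z z hτ
      ((integral_gaussRoot_sub_sq_le_of_scale (by positivity) hd he z).trans hH)
      (A := 185 * d ^ 2) (B := 365 * d ^ 2)
      (by rw [← hn_def, hbn, hzx]; nlinarith)
      (by rw [← hn_def, hcn, hzx]; nlinarith)
    have e1 : n / d ^ 2 / 2 * ‖x - z‖ ^ 2 / (2 * (s * t / d ^ 2)) +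
        s * t / d ^ 2 * (176 * d ^ 2 + 185 * d ^ 2) = (1 / 4 + 361) * (s * t) := by
      rw [← dist_eq_norm, ← ht_def, ← hss]
      field_simp
      ring
    have e2 : 2 * n * (t ^ 2 / d ^ 2) / (2 * (s * t / d ^ 2)) +
        s * t / d ^ 2 * (185 * d ^ 2 + 365 * d ^ 2) = 551 * (s * t) := by
      rw [← hss]
      field_simp
      ring
    rw [e1] at h1
    rw [e2] at h2
    rw [hsplit]
    refine (norm_add_le _ _).trans ((add_le_add h1 h2).trans ?_)
    have : 0 ≤ s * t := by positivity
    linarith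

/-- The Dirac map of a closed subset of an `n`-dimensional Euclidean space has a Lipschitz extension
with constant of order `√n`. -/
theorem exists_lipschitz_extension_diracMk (hF : IsClosed F) (hn : 0 < Module.finrank ℝ V) (a : F) :
    ∃ Φ : V → FreeBanach F a,
      (∀ x y, ‖Φ x - Φ y‖ ≤ 1000 * Real.sqrt (Module.finrank ℝ V) * dist x y) ∧
        ∀ x : F, Φ x = diracMk a x := by
  obtain ⟨r, hrm, hr⟩ := exists_measurable_almost_nearest hF ⟨a, a.2⟩
  exact ⟨gaussExtension a r, norm_gaussExtension_sub_gaussExtension_le hF hn hrm hr,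
    fun x => dif_pos x.2⟩

end Extension

/-! ### Bounded approximation for Euclidean spaces -/

section BoundedApproximation

variable {V : Type*} [NormedAddCommGroup V] [InnerProductSpace ℝ V]

/-- The radial retraction onto the closed ball of radius `R` about the origin. -/
def radialRetraction (R : ℝ) (x : V) : V := (R / max R ‖x‖) • x

theorem radialRetraction_of_norm_le {R : ℝ} (hR : 0 < R) {x : V} (hx : ‖x‖ ≤ R) :
    radialRetraction R x = x := by
  rw [radialRetraction, max_eq_left hx, div_self hR.ne', one_smul]

theorem norm_radialRetraction_le {R : ℝ} (hR : 0 < R) (x : V) : ‖radialRetraction R x‖ ≤ R := by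
  have hm : 0 < max R ‖x‖ := lt_max_of_lt_left hR
  rw [radialRetraction, norm_smul, Real.norm_of_nonneg (by positivity), div_mul_eq_mul_div,
    div_le_iff₀ hm]
  exact mul_le_mul_of_nonneg_left (le_max_right _ _) hR.le

theorem continuous_radialRetraction {R : ℝ} (hR : 0 < R) :
    Continuous (radialRetraction R : V → V) := by
  unfold radialRetraction
  have (x : V) : max R ‖x‖ ≠ 0 := (lt_max_of_lt_left hR).ne'
  fun_prop (disch := assumption)

theorem dist_radialRetraction_le {R : ℝ} (hR : 0 < R) (x y : V) :
    dist (radialRetraction R x) (radialRetraction R y) ≤ 2 * dist x y := by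
  have hx : 0 < max R ‖x‖ := lt_max_of_lt_left hR
  have hy : 0 < max R ‖y‖ := lt_max_of_lt_left hR
  have h1 : radialRetraction R x - radialRetraction R y =
      (R / max R ‖x‖) • (x - y) + (R / max R ‖x‖ - R / max R ‖y‖) • y := by
    unfold radialRetraction
    module
  have h2 : ‖(R / max R ‖x‖) • (x - y)‖ ≤ ‖x - y‖ := by
    rw [norm_smul, Real.norm_of_nonneg (by positivity)]
    exact mul_le_of_le_one_left (norm_nonneg _) ((div_le_one hx).2 (le_max_left _ _))
  have h3 : ‖(R / max R ‖x‖ - R / max R ‖y‖) • y‖ ≤ ‖x - y‖ := by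
    have h4 : R / max R ‖x‖ - R / max R ‖y‖ =
        R / max R ‖x‖ * (1 / max R ‖y‖) * (max R ‖y‖ - max R ‖x‖) := by
      field_simp
    have h5 : |max R ‖y‖ - max R ‖x‖| ≤ ‖x - y‖ := by
      refine (abs_max_sub_max_le_max R ‖y‖ R ‖x‖).trans ?_
      rw [sub_self, abs_zero, norm_sub_rev]
      exact max_le (norm_nonneg _) (abs_norm_sub_norm_le y x)
    rw [norm_smul, Real.norm_eq_abs, h4, abs_mul, abs_of_nonneg (by positivity)]
    calc R / max R ‖x‖ * (1 / max R ‖y‖) * |max R ‖y‖ - max R ‖x‖| * ‖y‖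
        = R / max R ‖x‖ * (‖y‖ / max R ‖y‖) * |max R ‖y‖ - max R ‖x‖| := by ring
      _ ≤ 1 * 1 * ‖x - y‖ := by
        gcongr
        · exact (div_le_one hx).2 (le_max_left _ _)
        · exact (div_le_one hy).2 (le_max_right _ _)
      _ = ‖x - y‖ := by ring
  rw [dist_eq_norm, dist_eq_norm, h1]
  linarith [norm_add_le ((R / max R ‖x‖) • (x - y)) ((R / max R ‖x‖ - R / max R ‖y‖) • y)]

variable [FiniteDimensional ℝ V] [MeasurableSpace V] [BorelSpace V]

theorem exists_simpleFunc_near_radialRetraction {R ε : ℝ} (hR : 0 < R) (hε : 0 < ε) :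
    ∃ s : SimpleFunc V V, ∀ y, dist (s y) (radialRetraction R y) ≤ ε := by
  have hcov : Metric.closedBall (0 : V) R ⊆
      ⋃ k, Metric.ball (TopologicalSpace.denseSeq V k) ε := by
    intro x _
    obtain ⟨k, hk⟩ := (TopologicalSpace.denseRange_denseSeq V).exists_dist_lt x hε
    exact Set.mem_iUnion.2 ⟨k, hk⟩
  obtain ⟨t, ht⟩ := (isCompact_closedBall (0 : V) R).elim_finite_subcover _
    (fun k => Metric.isOpen_ball) hcov
  refine ⟨(SimpleFunc.nearestPt (TopologicalSpace.denseSeq V) (t.sup id)).comp (radialRetraction R)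
    (continuous_radialRetraction hR).measurable, fun y => ?_⟩
  have hy : radialRetraction R y ∈ Metric.closedBall (0 : V) R := by
    simpa using norm_radialRetraction_le hR y
  obtain ⟨k, hk, hky⟩ := Set.mem_iUnion₂.1 (ht hy)
  have h := SimpleFunc.edist_nearestPt_le (TopologicalSpace.denseSeq V) (radialRetraction R y)
    (Finset.le_sup (f := id) hk)
  rw [edist_dist, edist_dist, ENNReal.ofReal_le_ofReal_iff dist_nonneg] at h
  refine h.trans ?_
  rw [dist_comm]
  exact (Metric.mem_ball.1 hky).le

theorem integrable_gaussRoot_sq_smul_simpleFunc {E : Type*} [NormedAddCommGroup E] [NormedSpace ℝ E]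
    {b : ℝ} (hb : 0 < b) (x : V) (s : SimpleFunc V E) :
    Integrable fun y => gaussRoot b x y ^ 2 • s y := by
  obtain ⟨C, hC⟩ := s.exists_forall_norm_le
  refine ((integrable_gaussRoot_sq hb x).mul_const C).mono'
    (((continuous_gaussRoot b x).pow 2).aestronglyMeasurable.smul
      s.stronglyMeasurable.aestronglyMeasurable) (Eventually.of_forall fun y => ?_)
  rw [norm_smul, Real.norm_of_nonneg (sq_nonneg _)]
  exact mul_le_mul_of_nonneg_left (hC y) (sq_nonneg _)

theorem gaussMean_simpleFunc_mem {E : Type*} [NormedAddCommGroup E] [NormedSpace ℝ E]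
    [CompleteSpace E] {b : ℝ} (hb : 0 < b) (x : V) (s : SimpleFunc V E)
    (W : Submodule ℝ E) [FiniteDimensional ℝ W]
    (hW : ∀ y, s y ∈ W) : gaussMean b x s ∈ W := by
  classical
  have := FiniteDimensional.complete ℝ W
  let f : SimpleFunc V W := s.map fun e => if h : e ∈ W then ⟨e, h⟩ else 0
  have hf (y : V) : W.subtypeL (f y) = s y := by simp [f, hW y]
  have h := W.subtypeL.integral_comp_comm (integrable_gaussRoot_sq_smul_simpleFunc hb x f)
  simp_rw [map_smul, hf] at h
  rw [gaussMean, h]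
  exact Subtype.property _

theorem norm_gaussMean_sub_le_of_lipschitz {E : Type*} [NormedAddCommGroup E] [NormedSpace ℝ E]
    {b : ℝ} (hb : 0 < b) (hn : 0 < Module.finrank ℝ V) {v : V → E} (hv : StronglyMeasurable v)
    {L : ℝ} (hL : ∀ y z, ‖v y - v z‖ ≤ L * dist y z) (x z : V) :
    ‖gaussMean b x v - gaussMean b z v‖ ≤ L * dist x z := by
  have hI (q : V) : Integrable fun y => gaussRoot b 0 y ^ 2 • v (y + q) := by
    refine integrable_gaussRoot_sq_smul hb hn (α := ‖v 0‖) (β := L) (z := -q)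
      (hv.comp_measurable (measurable_add_const q)) (fun y => ?_) 0
    have h1 := hL (y + q) 0
    rw [dist_zero_right] at h1
    rw [sub_neg_eq_add, Function.comp_apply]
    linarith [norm_le_norm_add_norm_sub' (v (y + q)) (v 0)]
  have hshift (q : V) : gaussMean b q v = gaussMean b 0 fun y => v (y + q) := by
    rw [gaussMean, ← integral_add_right_eq_self _ q]
    simp_rw [gaussRoot_add]
    rfl
  have hsub : gaussMean b x v - gaussMean b z v = gaussMean b 0 fun y => v (y + x) - v (y + z) := by
    rw [hshift, hshift, gaussMean, gaussMean, ← integral_sub (hI x) (hI z)]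
    simp_rw [← smul_sub]
    rfl
  rw [hsub]
  refine (norm_gaussMean_le hb hn (α := L * dist x z) (β := 0) le_rfl (fun y => ?_)
    one_pos).trans_eq ?_
  · refine (hL _ _).trans_eq ?_
    rw [dist_add_left, zero_mul, add_zero]
  · rw [zero_mul, add_zero]

/-- Averages at scale `ε` of a function `δ ∘ s`, with `s` of finite range and within `ε` of a
retraction onto a large ball: the discretization error `ε` is matched to the scale, so that it adds
only a constant to the Lipschitz constant. -/
theorem exists_finite_rank_approximation (o : V) (hn : 0 < Module.finrank ℝ V) {R ε : ℝ}
    (hR : 0 < R) (hε : 0 < ε) :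
    ∃ (Ψ : V → FreeBanach V o) (W : Submodule ℝ (FreeBanach V o)), FiniteDimensional ℝ W ∧
      (∀ x, Ψ x ∈ W) ∧ (∀ x z, ‖Ψ x - Ψ z‖ ≤ 4 * dist x z) ∧
      ∀ x, ‖x‖ ≤ R → ‖Ψ x - diracMk o x‖ ≤ (3 + 8 * Module.finrank ℝ V) * ε := by
  obtain ⟨s, hs⟩ := exists_simpleFunc_near_radialRetraction (V := V) hR hε
  set b := 1 / ε ^ 2 with hb_def
  have hb : 0 < b := by positivity
  let v : SimpleFunc V (FreeBanach V o) := s.map (diracMk o)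
  have hIv (x : V) : Integrable fun y => gaussRoot b x y ^ 2 • v y :=
    integrable_gaussRoot_sq_smul_simpleFunc hb x v
  refine ⟨fun x => gaussMean b x v, Submodule.span ℝ (Set.range v),
    FiniteDimensional.span_of_finite ℝ v.finite_range, fun x => ?_, fun x z => ?_, fun x hx => ?_⟩
  · have := FiniteDimensional.span_of_finite ℝ v.finite_range
    exact gaussMean_simpleFunc_mem hb x v _ fun y => Submodule.subset_span ⟨y, rfl⟩
  · rcases eq_or_ne x z with rfl | hxz
    · simp
    have ht : 0 < dist x z := dist_pos.2 hxz
    let w (y : V) : FreeBanach V o := diracMk o (radialRetraction R y)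
    have hwm : StronglyMeasurable w := (continuous_diracMk.comp
      (continuous_radialRetraction hR)).stronglyMeasurable
    have hwL (y z : V) : ‖w y - w z‖ ≤ 2 * dist y z :=
      (norm_diracMk_sub_le _ _).trans (dist_radialRetraction_le hR y z)
    have hIw (x : V) : Integrable fun y => gaussRoot b x y ^ 2 • w y := by
      refine integrable_gaussRoot_sq_smul hb hn (α := ‖w 0‖) (β := 2) (z := 0) hwm (fun y => ?_) x
      have h1 := hwL y 0
      rw [dist_eq_norm] at h1
      linarith [norm_le_norm_add_norm_sub' (w y) (w 0)]
    have hvw (y : V) : ‖v y - w y‖ ≤ ε + 0 * ‖y - 0‖ := by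
      rw [zero_mul, add_zero]
      exact (norm_diracMk_sub_le _ _).trans (hs y)
    have hmean (x : V) : gaussMean b x v =
        gaussMean b x (fun y => v y - w y) + gaussMean b x w := by
      simp_rw [gaussMean, smul_sub]
      rw [integral_sub (hIv x) (hIw x), sub_add_cancel]
    have h1 := norm_gaussMean_sub_le hb hb hn (v.stronglyMeasurable.sub hwm) hvw x z
      (τ := dist x z / (4 * ε ^ 2)) (by positivity) (integral_gaussRoot_sub_sq_le_of_center hb x z)
      (A := 2 * ε ^ 2) (B := 2 * ε ^ 2) (by simp) (by simp)
    have h2 := norm_gaussMean_sub_le_of_lipschitz hb hn hwm hwL x z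
    have h3 : b / 2 * ‖x - z‖ ^ 2 / (2 * (dist x z / (4 * ε ^ 2))) +
        dist x z / (4 * ε ^ 2) * (2 * ε ^ 2 + 2 * ε ^ 2) = 2 * dist x z := by
      rw [← dist_eq_norm, hb_def]
      field_simp
      norm_num
    rw [h3] at h1
    beta_reduce
    rw [hmean x, hmean z, add_sub_add_comm]
    refine (norm_add_le _ _).trans ((add_le_add h1 h2).trans_eq ?_)
    ring
  · rw [← gaussMean_sub_const hb (hIv x)]
    have hw (y : V) : ‖v y - diracMk o x‖ ≤ ε + 2 * ‖y - x‖ := by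
      refine (norm_diracMk_sub_le _ _).trans
        ((dist_triangle _ (radialRetraction R y) _).trans (add_le_add (hs y) ?_))
      have h1 := dist_radialRetraction_le hR y x
      rwa [radialRetraction_of_norm_le hR hx, dist_eq_norm y x] at h1
    refine (norm_gaussMean_le hb hn zero_le_two hw hε).trans_eq ?_
    rw [hb_def]
    field_simp
    ring

/-- The Lipschitz-free spaces of Euclidean spaces have the bounded approximation property with a
constant that does not depend on the dimension. -/
theorem hasBAP_freeBanach (o : V) (hn : 0 < Module.finrank ℝ V) : HasBAP 4 (FreeBanach V o) := by
  have hpos (k : ℕ) : (0 : ℝ) < k + 1 := by positivity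
  choose Ψ W hfin hW hL hΨ using fun k : ℕ =>
    exists_finite_rank_approximation o hn (hpos k) (inv_pos.2 (hpos k))
  have hlift (k : ℕ) := exists_lift (o := o) (fun x => Ψ k x - Ψ k o) (L := 4) (by norm_num)
    (fun x y => by rw [sub_sub_sub_cancel_right]; exact hL k x y) (sub_self _)
  choose S hS hSd _ using hlift
  refine hasBAP_of_tendsto_diracMk (by norm_num) S hS (fun k => ?_) fun x => ?_
  · have hle : LinearMap.range (S k : FreeBanach V o →ₗ[ℝ] FreeBanach V o) ≤ W k := by
      rintro _ ⟨μ, rfl⟩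
      have := hfin k
      refine mem_of_diracMk_mem (p := (W k).comap (S k).toLinearMap)
        ((W k).closed_of_finiteDimensional.preimage (S k).continuous) (fun x => ?_) μ
      change S k (diracMk o x) ∈ W k
      rw [hSd]
      exact (W k).sub_mem (hW k x) (hW k o)
    have := hfin k
    exact Submodule.finiteDimensional_of_le hle
  · have hlim (z : V) : Tendsto (fun k => Ψ k z) atTop (𝓝 (diracMk o z)) := by
      rw [tendsto_iff_norm_sub_tendsto_zero]
      have h0 : Tendsto (fun k : ℕ => (3 + 8 * Module.finrank ℝ V : ℝ) * ((k : ℝ) + 1)⁻¹) atTop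
          (𝓝 0) := by
        simpa [one_div] using (tendsto_one_div_add_atTop_nhds_zero_nat (𝕜 := ℝ)).const_mul
          (3 + 8 * Module.finrank ℝ V : ℝ)
      refine squeeze_zero' (Eventually.of_forall fun k => norm_nonneg _) ?_ h0
      filter_upwards [eventually_ge_atTop ⌈‖z‖⌉₊] with k hk
      refine hΨ k z ((Nat.le_ceil _).trans ?_)
      have : (⌈‖z‖⌉₊ : ℝ) ≤ k := by exact_mod_cast hk
      linarith
    simp_rw [hSd]
    simpa [diracMk_base] using (hlim x).sub (hlim o)

end BoundedApproximation

end LipFree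

open LipFree in
theorem proposition2p3 :
    ∃ C : ℝ, 0 < C ∧
      ∀ (N : ℕ), 1 ≤ N →
        ∀ (F : Set (EuclideanSpace ℝ (Fin N))), IsClosed F →
          ∀ (a : F) (b : EuclideanSpace ℝ (Fin N)),
            LipFree.IsometricToComplemented (C * Real.sqrt N)
              (LipFree.FreeSpace F a) (LipFree.FreeSpace (EuclideanSpace ℝ (Fin N)) b) ∧
            LipFree.HasBAP (C * Real.sqrt N) (LipFree.FreeSpace F a) := by
  refine ⟨4000, by norm_num, fun N hN F hF a b => ?_⟩
  have hrank : Module.finrank ℝ (EuclideanSpace ℝ (Fin N)) = N := finrank_euclideanSpace_fin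
  have hn : 0 < Module.finrank ℝ (EuclideanSpace ℝ (Fin N)) := by omega
  have hs : 1 ≤ Real.sqrt N := Real.one_le_sqrt.2 (by exact_mod_cast hN)
  obtain ⟨Φ, hΦ, hΦF⟩ := exists_lipschitz_extension_diracMk hF hn a
  rw [hrank] at hΦ
  obtain ⟨J, Q, hQ, hQJ⟩ := exists_retraction a b (by positivity) Φ hΦ hΦF
  have h1 : IsometricToComplemented (4000 * Real.sqrt N) (FreeBanach F a)
      (FreeBanach (EuclideanSpace ℝ (Fin N)) b) :=
    isometricToComplemented_of_leftInverse J Q (by linarith) hQJ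
  have h2 : HasBAP (4000 * Real.sqrt N) (FreeBanach F a) :=
    (hasBAP_freeBanach b hn).of_leftInverse J Q hQ hQJ (by linarith) (by linarith)
  -- `FreeBanach` is `FreeSpace` by definition, with the same normed space structure
  exact ⟨h1, h2⟩

end
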